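/- Let $n\ge 1$. A spherical simplex in the unit sphere $S^{n-1}\subset\mathbb{E}^n$ is a set $\{x\in S^{n-1} : \langle f_k,x\rangle\le 0,\ k=1,\dots,n\}$, where $f_1,\dots,f_n$ are linearly independent unit vectors (its outward facet normals). The $n$ hyperplanes $f_k^{\perp}$ cut $S^{n-1}$ into $2^n$ simplices, with normals $\pm f_1,\dots,\pm f_n$; the set of these $2^n$ simplices is called a family. All simplices of a family generate the same group, namely the group generated by the reflections in the hyperplanes $f_k^{\perp}$. Two families are identified if an isometry of $S^{n-1}$ carries one to the other. Let $h_0,\dots,h_n$ be the standard basis of $\mathbb{R}^{n+1}$, let $V=\{x\in\mathbb{R}^{n+1}:\sum_i x_i=0\}$, and let the Weyl group of $A_n$ be the group of isometries of $V$ generated by the reflections in the hyperplanes of $V$ orthogonal to the roots $h_i-h_j$ $(i\ne j)$. A family generates $A_n$ if some linear isometry $\mathbb{E}^n\to V$ conjugates the group that it generates to the Weyl group of $A_n$. Theorem. For every family generating $A_n$ there is a linear isometry $\varphi:\mathbb{E}^n\to V$ for which every $\varphi(f_k)$ is a nonzero multiple of a root. For every such $\varphi$, the graph on the vertices $0,\dots,n$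 in which $i\neq j$ are joined by an edge exactly when $\pm(h_i-h_j)$ is, up to normalization, one of the vectors $\pm\varphi(f_k)$, is a tree. Its isomorphism class depends only on the isometry class of the family, and assigning it to the family defines a one-to-one correspondence between the isometry classes of families generating $A_n$ and the isomorphism classes of trees with $n+1$ vertices. -/

import Mathlib

/-- The Euclidean space `E^n`; its unit sphere is `S^{n-1}`. -/
abbrev EuSp (n : ℕ) : Type := EuclideanSpace ℝ (Fin n)

/-- `f` lists the unit normal vectors of `n` linearly independent hyperplanes through the origin of
`E^n`. -/
def IsNormalSystem {n : ℕ} (f : Fin n → EuSp n) : Prop :=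
  LinearIndependent ℝ f ∧ ∀ k, ‖f k‖ = 1

/-- The spherical simplex in `S^{n-1}` whose outward facet normals are `f 0, …, f (n-1)`. -/
def sphericalSimplex {n : ℕ} (f : Fin n → EuSp n) : Set (EuSp n) :=
  {x | ‖x‖ = 1 ∧ ∀ k, inner ℝ (f k) x ≤ 0}

/-- The family determined by `f`: the set of the `2^n` spherical simplices into which the
hyperplanes orthogonal to the `f k` cut the sphere, i.e. those with normals `± f k`. -/
def simplexFamily {n : ℕ} (f : Fin n → EuSp n) : Set (Set (EuSp n)) :=
  Set.range fun ε : Fin n → ℤˣ => sphericalSimplex fun k => ε k • f k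

/-- The group generated by the reflections in the facets of the simplex with normals `f`
(it does not change when the signs of the `f k` change). -/
noncomputable def facetReflectionGroup {n : ℕ} (f : Fin n → EuSp n) :
    Subgroup (EuSp n ≃ₗᵢ[ℝ] EuSp n) :=
  Subgroup.closure (Set.range fun k => (Submodule.span ℝ {f k})ᗮ.reflection)

/-- The `n`-dimensional hyperplane `x_0 + … + x_n = 0` of `ℝ^{n+1}`, spanned by the root
system `A_n`. -/
def sumZero (n : ℕ) : Submodule ℝ (EuSp (n + 1)) where
  carrier := {x | ∑ i, x i = 0}
  add_mem' := by
    intro x y hx hy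
    simp only [Set.mem_ofPred_eq] at hx hy ⊢
    simp [Finset.sum_add_distrib, hx, hy]
  zero_mem' := by simp
  smul_mem' := by
    intro c x hx
    simp only [Set.mem_ofPred_eq] at hx ⊢
    simp [← Finset.mul_sum, hx]

/-- The vector `h_i - h_j`, where `h_0, …, h_n` is the standard basis of `ℝ^{n+1}`. For `i ≠ j`
these are the roots of `A_n`. -/
noncomputable def rootA {n : ℕ} (i j : Fin (n + 1)) : sumZero n :=
  ⟨EuclideanSpace.single i (1 : ℝ) - EuclideanSpace.single j (1 : ℝ), by
    change ∑ k, (EuclideanSpace.single i (1 : ℝ) - EuclideanSpace.single j (1 : ℝ) :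
      EuSp (n + 1)) k = 0
    simp [Finset.sum_sub_distrib]⟩

theorem rootA_swap {n : ℕ} (i j : Fin (n + 1)) : rootA j i = -rootA i j := by
  apply Subtype.ext
  simp [rootA]

/-- The Weyl group of `A_n`, acting on the hyperplane `x_0 + … + x_n = 0`. -/
noncomputable def weylA (n : ℕ) : Subgroup (sumZero n ≃ₗᵢ[ℝ] sumZero n) :=
  Subgroup.closure
    {s | ∃ i j : Fin (n + 1), i ≠ j ∧ s = (Submodule.span ℝ {rootA i j})ᗮ.reflection}

/-- A group of isometries of `E^n` is the reflection group `A_n` if an isometry of `E^n` onto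
the hyperplane `x_0 + … + x_n = 0` conjugates it to the Weyl group of `A_n`. -/
def IsReflectionGroupA {n : ℕ} (G : Subgroup (EuSp n ≃ₗᵢ[ℝ] EuSp n)) : Prop :=
  ∃ φ : EuSp n ≃ₗᵢ[ℝ] sumZero n, ∀ g, g ∈ G ↔ (φ.symm.trans g).trans φ ∈ weylA n

/-- `Φ` is a family of spherical simplices that generates `A_n`. -/
def GeneratesA {n : ℕ} (Φ : Set (Set (EuSp n))) : Prop :=
  ∃ f : Fin n → EuSp n, IsNormalSystem f ∧ Φ = simplexFamily f ∧
    IsReflectionGroupA (facetReflectionGroup f)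

/-- The families (in `S^{n-1}`) generating `A_n`. -/
abbrev FamilyA (n : ℕ) : Type := {Φ : Set (Set (EuSp n)) // GeneratesA Φ}

/-- Two families are congruent if an isometry of the sphere (an orthogonal map of `E^n`) carries
the simplices of the one onto the simplices of the other. -/
def FamilyCongruent {n : ℕ} (Φ Ψ : Set (Set (EuSp n))) : Prop :=
  ∃ T : EuSp n ≃ₗᵢ[ℝ] EuSp n, (fun P => T '' P) '' Φ = Ψ

theorem FamilyCongruent.refl {n : ℕ} (Φ : Set (Set (EuSp n))) : FamilyCongruent Φ Φ :=
  ⟨LinearIsometryEquiv.refl ℝ _, by simp⟩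

theorem FamilyCongruent.symm {n : ℕ} {Φ Ψ : Set (Set (EuSp n))} (h : FamilyCongruent Φ Ψ) :
    FamilyCongruent Ψ Φ := by
  obtain ⟨T, rfl⟩ := h
  exact ⟨T.symm, by simp [Set.image_image]⟩

theorem FamilyCongruent.trans {n : ℕ} {Φ Ψ Ω : Set (Set (EuSp n))} (h : FamilyCongruent Φ Ψ)
    (h' : FamilyCongruent Ψ Ω) : FamilyCongruent Φ Ω := by
  obtain ⟨T, rfl⟩ := h
  obtain ⟨U, rfl⟩ := h'
  exact ⟨T.trans U, by simp [Set.image_image]⟩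

/-- Congruence of families generating `A_n`. -/
def familySetoid (n : ℕ) : Setoid (FamilyA n) where
  r Φ Ψ := FamilyCongruent Φ.1 Ψ.1
  iseqv := ⟨fun Φ => .refl Φ.1, fun h => h.symm, fun h h' => h.trans h'⟩

/-- The families generating `A_n`, up to isometry. -/
abbrev FamilyClassA (n : ℕ) : Type := Quotient (familySetoid n)

/-- The trees with vertices `0, …, n`. -/
abbrev TreeOn (n : ℕ) : Type := {Γ : SimpleGraph (Fin (n + 1)) // Γ.IsTree}

/-- Isomorphism of trees with `n + 1` vertices. -/
def treeSetoid (n : ℕ) : Setoid (TreeOn n) where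
  r Γ Δ := Nonempty (Γ.1 ≃g Δ.1)
  iseqv := ⟨fun _ => ⟨SimpleGraph.Iso.refl⟩, fun ⟨a⟩ => ⟨a.symm⟩,
    fun ⟨a⟩ ⟨b⟩ => ⟨a.trans b⟩⟩

/-- The trees with `n + 1` vertices, up to isomorphism. -/
abbrev TreeClass (n : ℕ) : Type := Quotient (treeSetoid n)

/-- The isometry `φ` embeds the normal system `f` into `A_n`: after normalization, each normal
vector is sent to a root. -/
def IsEmbeddingA {n : ℕ} (f : Fin n → EuSp n) (φ : EuSp n ≃ₗᵢ[ℝ] sumZero n) : Prop :=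
  ∀ k, ∃ i j : Fin (n + 1), i ≠ j ∧ ∃ c : ℝ, c ≠ 0 ∧ c • φ (f k) = rootA i j

/-- The graph of an embedded normal system: `i` and `j` are joined if `h_i - h_j` or `h_j - h_i`
is, after normalization, one of the vectors `± φ (f k)`. -/
def embeddingGraph {n : ℕ} (f : Fin n → EuSp n) (φ : EuSp n ≃ₗᵢ[ℝ] sumZero n) :
    SimpleGraph (Fin (n + 1)) where
  Adj i j := i ≠ j ∧ ∃ k, ∃ c : ℝ, c ≠ 0 ∧ c • φ (f k) = rootA i j
  symm := ⟨by
    rintro i j ⟨hij, k, c, hc, h⟩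
    exact ⟨hij.symm, k, -c, neg_ne_zero.mpr hc, by rw [rootA_swap i j, ← h, neg_smul]⟩⟩
  loopless := ⟨fun _ h => h.1 rfl⟩

/-- `Γ` is a graph of the family `Φ`: it is the graph of some embedding of (the normal vectors of)
`Φ` into `A_n`. -/
def IsGraphOfFamily {n : ℕ} (Φ : Set (Set (EuSp n))) (Γ : SimpleGraph (Fin (n + 1))) : Prop :=
  ∃ f : Fin n → EuSp n, IsNormalSystem f ∧ Φ = simplexFamily f ∧
    ∃ φ : EuSp n ≃ₗᵢ[ℝ] sumZero n, IsEmbeddingA f φ ∧ Γ = embeddingGraph f φ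

/-! Roots `h_i - h_j` are edges on the vertices `0, …, n`, and a choice of `n` of them is a basis of
`V` exactly when the edges form a tree: if the graph is disconnected, the indicator of a component
is orthogonal to all chosen roots; if it is connected, telescoping along walks yields every root.

The reflection in `h_i - h_j` transposes two coordinates (`reflection_rootA`), so the Weyl group
acts by permutations and its reflections are exactly those in roots. Hence an isometry conjugating
the group of a family to the Weyl group sends the normals to multiples of roots. Conversely,
transpositions along the edges of a connected graph generate all transpositions
(`map_facetReflectionGroup`), so every tree occurs.

For uniqueness, two embeddings of one normal system differ by an isometry permuting the roots, which
is a coordinate permutation up to sign (`exists_perm_of_map_roots`); the sign does not affect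
unordered edges. A family determines its normal lines because the normals of a simplex are the
extreme rays of the dual cone (`exists_smul_of_sphericalSimplex_eq`). Conversely, an isomorphism of
trees is a permutation of coordinates, hence an isometry matching the normal lines, and these lines
determine the family. -/

/-! ### Reflections and their conjugates. -/

section Reflections

variable {E F : Type*} [NormedAddCommGroup E] [InnerProductSpace ℝ E]
  [NormedAddCommGroup F] [InnerProductSpace ℝ F]

theorem reflection_orthogonal_singleton_apply (v x : E) :
    (Submodule.span ℝ {v})ᗮ.reflection x = x - (2 * (inner ℝ v x / ‖v‖ ^ 2)) • v := by
  rw [Submodule.reflection_orthogonal_apply, Submodule.reflection_singleton_apply, mul_smul]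
  simp [two_smul]

theorem reflection_orthogonal_singleton_smul {c : ℝ} (hc : c ≠ 0) (v : E) :
    (Submodule.span ℝ {c • v})ᗮ.reflection = (Submodule.span ℝ {v})ᗮ.reflection := by
  ext x
  rw [reflection_orthogonal_singleton_apply, reflection_orthogonal_singleton_apply, smul_smul,
    real_inner_smul_left, norm_smul, mul_pow, Real.norm_eq_abs, sq_abs]
  congr 2
  by_cases hv : ‖v‖ = 0
  · simp [hv]
  · field_simp

theorem reflection_orthogonal_singleton_congr {c : ℝ} (hc : c ≠ 0) {v w : E} (h : c • v = w) :
    (Submodule.span ℝ {w})ᗮ.reflection = (Submodule.span ℝ {v})ᗮ.reflection := by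
  subst h
  exact reflection_orthogonal_singleton_smul hc v

/-- Conjugation by a linear isometry. -/
def isometryConj (φ : E ≃ₗᵢ[ℝ] F) : (E ≃ₗᵢ[ℝ] E) ≃* (F ≃ₗᵢ[ℝ] F) where
  toFun g := (φ.symm.trans g).trans φ
  invFun g := (φ.trans g).trans φ.symm
  left_inv g := by ext; simp
  right_inv g := by ext; simp
  map_mul' g h := by ext; simp

theorem isometryConj_apply (φ : E ≃ₗᵢ[ℝ] F) (g : E ≃ₗᵢ[ℝ] E) (x : F) :
    isometryConj φ g x = φ (g (φ.symm x)) := rfl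

theorem isometryConj_self (g h : E ≃ₗᵢ[ℝ] E) : isometryConj g h = g * h * g⁻¹ := rfl

theorem isometryConj_reflection (φ : E ≃ₗᵢ[ℝ] F) (v : E) :
    isometryConj φ (Submodule.span ℝ {v})ᗮ.reflection =
      (Submodule.span ℝ {φ v})ᗮ.reflection := by
  ext x
  rw [isometryConj_apply, reflection_orthogonal_singleton_apply,
    reflection_orthogonal_singleton_apply, map_sub, map_smul, φ.apply_symm_apply, φ.norm_map,
    ← φ.inner_map_map v, φ.apply_symm_apply]

end Reflections

/-! ### Roots of `A_n` and permutations of the coordinates. -/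

section Roots

variable {n : ℕ}

theorem rootA_apply (i j k : Fin (n + 1)) :
    (rootA i j).1 k = (if k = i then 1 else 0) - (if k = j then 1 else 0) := by
  simp [rootA]

theorem rootA_self (i : Fin (n + 1)) : rootA i i = 0 := by
  apply Subtype.ext
  simp [rootA]

theorem rootA_add (i j k : Fin (n + 1)) : rootA i j + rootA j k = rootA i k := by
  apply Subtype.ext
  simp [rootA]

theorem inner_rootA (i j : Fin (n + 1)) (x : sumZero n) :
    inner ℝ (rootA i j) x = x.1 i - x.1 j := by
  rw [Submodule.coe_inner]
  simp [rootA, inner_sub_left, EuclideanSpace.inner_single_left]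

theorem norm_rootA_sq {i j : Fin (n + 1)} (h : i ≠ j) : ‖rootA i j‖ ^ 2 = 2 := by
  rw [← real_inner_self_eq_norm_sq, inner_rootA, rootA_apply, rootA_apply]
  simp [h, h.symm]
  norm_num

theorem rootA_ne_zero {i j : Fin (n + 1)} (h : i ≠ j) : rootA i j ≠ 0 := by
  intro h0
  have := norm_rootA_sq h
  simp [h0] at this

theorem rootA_eq_iff {i j k l : Fin (n + 1)} (h : i ≠ j) :
    rootA i j = rootA k l ↔ i = k ∧ j = l := by
  refine ⟨fun e => ?_, by rintro ⟨rfl, rfl⟩; rfl⟩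
  have h1 := congrArg (fun x : sumZero n => x.1 i) e
  have h2 := congrArg (fun x : sumZero n => x.1 j) e
  simp only [rootA_apply] at h1 h2
  simp only [h, h.symm, if_true, if_false] at h1 h2
  constructor
  · by_contra hk
    rw [if_neg hk] at h1
    split_ifs at h1 <;> norm_num at h1
  · by_contra hk
    rw [if_neg hk] at h2
    split_ifs at h2 <;> norm_num at h2

/-- Proportional roots have the same support. -/
theorem sym2_eq_of_smul_rootA_eq {i j k l : Fin (n + 1)} (h : i ≠ j) (h' : k ≠ l) {c : ℝ}
    (e : c • rootA i j = rootA k l) : s(i, j) = s(k, l) := by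
  have hc : c ^ 2 = 1 := by
    have h1 := congrArg (fun x => ‖x‖ ^ 2) e
    simp only [norm_smul, mul_pow, norm_rootA_sq h, norm_rootA_sq h', Real.norm_eq_abs,
      sq_abs] at h1
    linarith
  rcases mul_self_eq_one_iff.mp ((sq c).symm.trans hc) with rfl | rfl
  · rw [one_smul, rootA_eq_iff h] at e
    rw [e.1, e.2]
  · rw [neg_one_smul, ← rootA_swap, rootA_eq_iff h.symm] at e
    rw [e.1, e.2, Sym2.eq_swap]

theorem sumZero_eq_sum (x : sumZero n) (a : Fin (n + 1)) : x = ∑ i, x.1 i • rootA i a := by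
  apply Subtype.ext
  ext k
  have hx : ∑ i, x.1 i = 0 := x.2
  simp only [Submodule.coe_sum, Submodule.coe_smul, WithLp.ofLp_sum, Finset.sum_apply,
    PiLp.smul_apply, rootA_apply, smul_eq_mul, mul_sub, Finset.sum_sub_distrib]
  rw [← Finset.sum_mul, hx]
  simp

theorem finrank_sumZero : Module.finrank ℝ (sumZero n) = n := by
  have : sumZero n = (Submodule.span ℝ {(WithLp.toLp 2 fun _ => 1 : EuSp (n + 1))})ᗮ := by
    ext x
    rw [Submodule.mem_orthogonal_singleton_iff_inner_right]
    change ∑ i, x i = 0 ↔ _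
    simp [PiLp.inner_apply]
  rw [this]
  have : Fact (Module.finrank ℝ (EuSp (n + 1)) = n + 1) := ⟨by simp⟩
  apply Submodule.finrank_orthogonal_span_singleton
  intro h
  have := congrArg (fun x : EuSp (n + 1) => x 0) h
  simp at this

/-- The action of a permutation of the coordinates. -/
noncomputable def permA (σ : Equiv.Perm (Fin (n + 1))) : sumZero n ≃ₗᵢ[ℝ] sumZero n where
  toFun x := ⟨LinearIsometryEquiv.piLpCongrLeft 2 ℝ ℝ σ x.1, by
    have hx : ∑ i, x.1 i = 0 := x.2
    change ∑ i, x.1 (σ.symm i) = 0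
    rw [← hx]
    exact Equiv.sum_comp σ.symm fun i => x.1 i⟩
  invFun x := ⟨LinearIsometryEquiv.piLpCongrLeft 2 ℝ ℝ σ.symm x.1, by
    have hx : ∑ i, x.1 i = 0 := x.2
    change ∑ i, x.1 (σ i) = 0
    rw [← hx]
    exact Equiv.sum_comp σ fun i => x.1 i⟩
  map_add' x y := by apply Subtype.ext; simp
  map_smul' c x := by apply Subtype.ext; simp
  left_inv x := by
    apply Subtype.ext
    ext i
    change x.1 (σ.symm (σ i)) = _
    simp
  right_inv x := by
    apply Subtype.ext
    ext i
    change x.1 (σ (σ.symm i)) = _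
    simp
  norm_map' x := by
    change ‖LinearIsometryEquiv.piLpCongrLeft 2 ℝ ℝ σ x.1‖ = ‖x.1‖
    simp

theorem permA_apply (σ : Equiv.Perm (Fin (n + 1))) (x : sumZero n) (i : Fin (n + 1)) :
    (permA σ x).1 i = x.1 (σ.symm i) := rfl

theorem permA_rootA (σ : Equiv.Perm (Fin (n + 1))) (i j : Fin (n + 1)) :
    permA σ (rootA i j) = rootA (σ i) (σ j) := by
  apply Subtype.ext
  ext k
  simp only [permA_apply, rootA_apply, Equiv.symm_apply_eq]

/-- A root has squared length 2, so the reflection subtracts `(x_a - x_b)(h_a - h_b)` from `x`,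
which exchanges the two coordinates. -/
theorem reflection_rootA {a b : Fin (n + 1)} (h : a ≠ b) :
    (Submodule.span ℝ {rootA a b})ᗮ.reflection = permA (Equiv.swap a b) := by
  ext x k
  rw [reflection_orthogonal_singleton_apply, norm_rootA_sq h, inner_rootA]
  rw [permA_apply, Equiv.symm_swap]
  simp only [Submodule.coe_sub, Submodule.coe_smul, PiLp.sub_apply, PiLp.smul_apply, rootA_apply,
    smul_eq_mul]
  by_cases ha : k = a
  · subst ha
    simp [h]
    ring
  · by_cases hb : k = b
    · subst hb
      simp [ha]
      ring
    · simp [ha, hb, Equiv.swap_apply_of_ne_of_ne]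

theorem exists_perm_of_mem_weylA {g : sumZero n ≃ₗᵢ[ℝ] sumZero n} (hg : g ∈ weylA n) :
    ∃ σ, g = permA σ := by
  induction hg using Subgroup.closure_induction with
  | mem s hs =>
    obtain ⟨i, j, hij, rfl⟩ := hs
    exact ⟨_, reflection_rootA hij⟩
  | one => exact ⟨1, by ext x i; rfl⟩
  | mul g h _ _ ih ih' =>
    obtain ⟨σ, rfl⟩ := ih
    obtain ⟨τ, rfl⟩ := ih'
    exact ⟨σ * τ, by ext x i; rfl⟩
  | inv g _ ih =>
    obtain ⟨σ, rfl⟩ := ih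
    exact ⟨σ⁻¹, by ext x i; rfl⟩

/-- Every reflection in the Weyl group is the reflection in a root. -/
theorem exists_rootA_of_reflection_mem_weylA {v : sumZero n} (hv : v ≠ 0)
    (hg : (Submodule.span ℝ {v})ᗮ.reflection ∈ weylA n) :
    ∃ i j : Fin (n + 1), i ≠ j ∧ ∃ c : ℝ, c ≠ 0 ∧ c • v = rootA i j := by
  obtain ⟨σ, hσ⟩ := exists_perm_of_mem_weylA hg
  -- The reflection negates `v ≠ 0`, so it is not the identity.
  have hne : ∃ i, σ i ≠ i := by
    by_contra! hid
    have h1 : permA σ v = v := by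
      apply Subtype.ext
      ext k
      rw [permA_apply, (Equiv.symm_apply_eq σ).2 (hid k).symm]
    rw [← hσ, Submodule.reflection_orthogonal_apply, Submodule.reflection_mem_subspace_eq_self
      (Submodule.mem_span_singleton_self v), neg_eq_iff_add_eq_zero, ← two_smul ℝ v,
      smul_eq_zero] at h1
    simp [hv] at h1
  obtain ⟨i, hi⟩ := hne
  have hinv : ∀ x, permA σ (permA σ x) = x := fun x => by
    rw [← hσ, Submodule.reflection_reflection]
  have hσσ : σ (σ i) = i := by
    have h1 := hinv (rootA (σ i) i)
    rw [permA_rootA, permA_rootA, rootA_eq_iff] at h1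
    · exact h1.2
    · simpa using hi
  -- Since `σ` exchanges `i` and `σ i`, the reflection negates this root, which must therefore be a
  -- multiple of `v`.
  have h2 := reflection_orthogonal_singleton_apply v (rootA i (σ i))
  rw [hσ, permA_rootA, hσσ, rootA_swap i (σ i)] at h2
  set c := 2 * (inner ℝ v (rootA i (σ i)) / ‖v‖ ^ 2)
  have h3 : (c / 2) • v = rootA i (σ i) := by
    have : c • v = (2 : ℝ) • rootA i (σ i) := by
      rwa [eq_sub_iff_add_eq, neg_add_eq_iff_eq_add, ← two_smul ℝ] at h2
    rw [div_eq_inv_mul, mul_smul, this, smul_smul]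
    norm_num
  refine ⟨i, σ i, hi.symm, c / 2, ?_, h3⟩
  intro h0
  rw [h0, zero_smul] at h3
  exact rootA_ne_zero hi.symm h3.symm

end Roots
-- The graph of an embedding is a tree, and its edges generate the Weyl group.
section Embeddings

variable {n : ℕ}

theorem IsNormalSystem.span_eq_top {f : Fin n → EuSp n} (hf : IsNormalSystem f) :
    Submodule.span ℝ (Set.range f) = ⊤ :=
  hf.1.span_eq_top_of_card_eq_finrank' (by simp)

theorem IsNormalSystem.map {f : Fin n → EuSp n} (hf : IsNormalSystem f)
    (T : EuSp n ≃ₗᵢ[ℝ] EuSp n) : IsNormalSystem fun k => T (f k) :=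
  ⟨hf.1.map' T.toLinearEquiv.toLinearMap T.toLinearEquiv.ker, fun k => by
    rw [T.norm_map, hf.2]⟩

/-- The indicator `u` of the component of `i` pairs to zero with the root of every edge, hence with
all of `V` because the normals span. If `j` lay in another component, `u` would pair to 1 with `h_i
- h_j`. -/
theorem embeddingGraph_connected {f : Fin n → EuSp n} {φ : EuSp n ≃ₗᵢ[ℝ] sumZero n}
    (hf : IsNormalSystem f) (hφ : IsEmbeddingA f φ) : (embeddingGraph f φ).Connected := by
  classical
  refine SimpleGraph.Connected.mk fun i j => ?_
  by_contra hij
  let u : EuSp (n + 1) :=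
    WithLp.toLp 2 fun m => if (embeddingGraph f φ).Reachable i m then 1 else 0
  have hu : ∀ a b, inner ℝ u (rootA a b).1 = u a - u b := fun a b => by
    simp [rootA, inner_sub_right, EuclideanSpace.inner_single_right]
  have hker : ∀ y ∈ Submodule.span ℝ (Set.range f), inner ℝ u (φ y).1 = 0 := by
    intro y hy
    induction hy using Submodule.span_induction with
    | mem y hy =>
      obtain ⟨k, rfl⟩ := hy
      obtain ⟨a, b, hab, c, hc, h⟩ := hφ k
      have hadj : (embeddingGraph f φ).Adj a b := ⟨hab, k, c, hc, h⟩
      have h1 := hu a b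
      have h2 : u a = u b := by
        have : (embeddingGraph f φ).Reachable i a ↔ (embeddingGraph f φ).Reachable i b :=
          ⟨fun h => h.trans hadj.reachable, fun h => h.trans hadj.reachable.symm⟩
        simp [u, this]
      rw [h2, sub_self, ← h, Submodule.coe_smul, real_inner_smul_right] at h1
      exact (mul_eq_zero.1 h1).resolve_left hc
    | zero => simp
    | add x y _ _ hx hy => rw [map_add, Submodule.coe_add, inner_add_right, hx, hy, add_zero]
    | smul c x _ hx => rw [map_smul, Submodule.coe_smul, real_inner_smul_right, hx, mul_zero]
  have h1 := hker (φ.symm (rootA i j)) (hf.span_eq_top ▸ Submodule.mem_top)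
  rw [φ.apply_symm_apply, hu] at h1
  simp [u, hij] at h1

/-- Normals correspond bijectively to edges: independent normals are never parallel, and
proportional roots have the same pair of indices. -/
theorem card_edgeSet_embeddingGraph {f : Fin n → EuSp n} {φ : EuSp n ≃ₗᵢ[ℝ] sumZero n}
    (hf : IsNormalSystem f) (hφ : IsEmbeddingA f φ) :
    Nat.card (embeddingGraph f φ).edgeSet = n := by
  choose a b hab c hc h using hφ
  let F : Fin n → (embeddingGraph f φ).edgeSet := fun k =>
    ⟨s(a k, b k), hab k, k, c k, hc k, h k⟩
  have hline : ∀ k l, ∀ d : ℝ, d ≠ 0 → ∀ d' : ℝ, d • φ (f k) = d' • φ (f l) → k = l := by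
    intro k l d hd d' e
    rw [← map_smul, ← map_smul] at e
    exact hf.1.eq_of_smul_apply_eq_smul_apply d d' k l hd (φ.injective e)
  have hF : Function.Bijective F := by
    constructor
    · intro k l e
      have e' : s(a k, b k) = s(a l, b l) := congrArg Subtype.val e
      rcases Sym2.eq_iff.1 e' with ⟨h1, h2⟩ | ⟨h1, h2⟩
      · exact hline k l (c k) (hc k) (c l) (by rw [h, h, h1, h2])
      · exact hline k l (c k) (hc k) (-c l) (by rw [neg_smul, h, h, h1, h2, rootA_swap])
    · rintro ⟨e, he⟩
      induction e using Sym2.ind with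
      | _ i j =>
        obtain ⟨hij, k, d, hd, hk⟩ := he
        refine ⟨k, Subtype.ext ?_⟩
        apply sym2_eq_of_smul_rootA_eq (hab k) hij (c := d / c k)
        rw [← h, smul_smul, div_mul_cancel₀ _ (hc k), hk]
  rw [← Nat.card_eq_of_bijective F hF, Nat.card_fin]

theorem embeddingGraph_isTree {f : Fin n → EuSp n} {φ : EuSp n ≃ₗᵢ[ℝ] sumZero n}
    (hf : IsNormalSystem f) (hφ : IsEmbeddingA f φ) : (embeddingGraph f φ).IsTree := by
  rw [SimpleGraph.isTree_iff_connected_and_card]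
  exact ⟨embeddingGraph_connected hf hφ, by
    rw [card_edgeSet_embeddingGraph hf hφ, Nat.card_fin]⟩

/-- A group containing the reflections in the edges of a graph contains the reflection in
`h_i - h_j` whenever `i` and `j` are joined by a walk. -/
theorem reflection_mem_of_reachable {Γ : SimpleGraph (Fin (n + 1))}
    {G : Subgroup (sumZero n ≃ₗᵢ[ℝ] sumZero n)}
    (hG : ∀ i j, Γ.Adj i j → (Submodule.span ℝ {rootA i j})ᗮ.reflection ∈ G)
    {i j : Fin (n + 1)} (h : Γ.Reachable i j) :
    (Submodule.span ℝ {rootA i j})ᗮ.reflection ∈ G := by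
  -- Walks may close up; the degenerate root is 0 and its reflection is the identity.
  have hself : ∀ i : Fin (n + 1), (Submodule.span ℝ {rootA i i})ᗮ.reflection ∈ G := fun i => by
    have : (Submodule.span ℝ {rootA i i})ᗮ.reflection = 1 := by
      ext x
      rw [reflection_orthogonal_singleton_apply, rootA_self]
      simp
    rw [this]
    exact G.one_mem
  obtain ⟨w⟩ := h
  induction w with
  | nil => exact hself _
  | @cons i j k hij w ih =>
    by_cases hik : i = k
    · subst hik
      exact hself i
    by_cases hjk : j = k
    · subst hjk
      exact hG _ _ hij
    have hne := hij.ne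
    -- Conjugating the transposition of `j, k` by that of `i, j` gives the transposition of `i, k`.
    have hmap : permA (Equiv.swap i j) (rootA j k) = rootA i k := by
      rw [permA_rootA, Equiv.swap_apply_right, Equiv.swap_apply_of_ne_of_ne (Ne.symm hik)
        (Ne.symm hjk)]
    have hswap : permA (Equiv.swap i j) ∈ G := reflection_rootA hij.ne ▸ hG _ _ hij
    have key := isometryConj_reflection (permA (Equiv.swap i j)) (rootA j k)
    rw [isometryConj_self] at key
    rw [reflection_orthogonal_singleton_congr one_ne_zero
      ((one_smul ℝ _).trans hmap), ← key]
    exact G.mul_mem (G.mul_mem hswap ih) (G.inv_mem hswap)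

/-- An embedding carries the group generated by a normal system onto the Weyl group. -/
theorem map_facetReflectionGroup {f : Fin n → EuSp n} {φ : EuSp n ≃ₗᵢ[ℝ] sumZero n}
    (hf : IsNormalSystem f) (hφ : IsEmbeddingA f φ) :
    (facetReflectionGroup f).map (isometryConj φ).toMonoidHom = weylA n := by
  apply le_antisymm
  · rw [facetReflectionGroup, MonoidHom.map_closure, Subgroup.closure_le]
    rintro _ ⟨_, ⟨k, rfl⟩, rfl⟩
    obtain ⟨i, j, hij, c, hc, h⟩ := hφ k
    refine Subgroup.subset_closure ⟨i, j, hij, ?_⟩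
    rw [reflection_orthogonal_singleton_congr hc h]
    exact isometryConj_reflection φ (f k)
  · rw [weylA, Subgroup.closure_le]
    rintro _ ⟨i, j, -, rfl⟩
    refine reflection_mem_of_reachable (Γ := embeddingGraph f φ) ?_
      ((embeddingGraph_connected hf hφ).preconnected i j)
    rintro i j ⟨-, k, c, hc, h⟩
    rw [reflection_orthogonal_singleton_congr hc h, ← isometryConj_reflection]
    exact Subgroup.mem_map_of_mem _ (Subgroup.subset_closure ⟨k, rfl⟩)

/-- The right-hand side does not involve `φ`, so any two embeddings of `f` pull the Weyl group back
to the same group. -/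
theorem isometryConj_mem_weylA_iff {f : Fin n → EuSp n} {φ : EuSp n ≃ₗᵢ[ℝ] sumZero n}
    (hf : IsNormalSystem f) (hφ : IsEmbeddingA f φ) (g : EuSp n ≃ₗᵢ[ℝ] EuSp n) :
    isometryConj φ g ∈ weylA n ↔ g ∈ facetReflectionGroup f := by
  rw [← map_facetReflectionGroup hf hφ]
  exact Subgroup.mem_map_iff_mem (f := (isometryConj φ).toMonoidHom) (isometryConj φ).injective

theorem IsNormalSystem.ne_zero {f : Fin n → EuSp n} (hf : IsNormalSystem f) (k : Fin n) :
    f k ≠ 0 := hf.1.ne_zero k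

theorem isEmbeddingA_of_conj {f : Fin n → EuSp n} (hf : IsNormalSystem f)
    {φ : EuSp n ≃ₗᵢ[ℝ] sumZero n}
    (h : ∀ g ∈ facetReflectionGroup f, isometryConj φ g ∈ weylA n) : IsEmbeddingA f φ := by
  intro k
  apply exists_rootA_of_reflection_mem_weylA
  · simpa using hf.ne_zero k
  · rw [← isometryConj_reflection]
    exact h _ (Subgroup.subset_closure ⟨k, rfl⟩)

end Embeddings

/-! ### Isometries permuting the roots. -/

section Automorphisms

variable {n : ℕ}

/-- The second indices of the images define the permutation, with `0` going to `a`. Differences of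
the roots `h_0 - h_i` give all other roots, and injectivity of `T` makes the map of indices
injective. -/
theorem exists_perm_of_common_index {T : sumZero n ≃ₗᵢ[ℝ] sumZero n} {a : Fin (n + 1)}
    (h : ∀ i, i ≠ 0 → ∃ b, T (rootA 0 i) = rootA a b) :
    ∃ σ : Equiv.Perm (Fin (n + 1)), ∀ i j, T (rootA i j) = rootA (σ i) (σ j) := by
  have h' : ∀ i, ∃ b, T (rootA 0 i) = rootA a b := by
    intro i
    by_cases hi : i = 0
    · exact ⟨a, by rw [hi, rootA_self, rootA_self, map_zero]⟩
    · exact h i hi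
  choose s hs using h'
  have key : ∀ i j, T (rootA i j) = rootA (s i) (s j) := fun i j => by
    rw [← rootA_add i 0 j, map_add, rootA_swap 0 i, map_neg, hs, hs, ← rootA_swap, rootA_add]
  have hinj : Function.Injective s := by
    intro i j e
    by_contra hij
    have h1 := key i j
    rw [e, rootA_self, map_eq_zero_iff _ T.injective] at h1
    exact rootA_ne_zero hij h1
  exact ⟨Equiv.ofBijective s (Finite.injective_iff_bijective.1 hinj), key⟩

/-- An isometry that permutes the roots of `A_n` is, up to sign, a permutation of the
coordinates. -/
theorem exists_perm_of_map_roots (T : sumZero n ≃ₗᵢ[ℝ] sumZero n)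
    (hT : ∀ i j : Fin (n + 1), i ≠ j → ∃ k l, k ≠ l ∧ T (rootA i j) = rootA k l) :
    ∃ σ : Equiv.Perm (Fin (n + 1)), (∀ i j, T (rootA i j) = rootA (σ i) (σ j)) ∨
      ∀ i j, T (rootA i j) = rootA (σ j) (σ i) := by
  have h0 : ∀ i : Fin (n + 1), ∃ a b, i ≠ 0 → a ≠ b ∧ T (rootA 0 i) = rootA a b := by
    intro i
    by_cases hi : i = 0
    · exact ⟨0, 0, fun h => absurd hi h⟩
    · obtain ⟨k, l, h⟩ := hT 0 i (Ne.symm hi)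
      exact ⟨k, l, fun _ => h⟩
  choose a b hab using h0
  -- The roots `h_0 - h_i` and `h_0 - h_j` have inner product 1, which for two roots means that they
  -- agree in exactly one of the first and second indices.
  have hinner : ∀ i j, i ≠ 0 → j ≠ 0 → i ≠ j →
      (a i = a j ∧ b i ≠ b j) ∨ (a i ≠ a j ∧ b i = b j) := by
    intro i j hi hj hij
    obtain ⟨h1, h2⟩ := hab i hi
    obtain ⟨h3, h4⟩ := hab j hj
    have h5 := T.inner_map_map (rootA 0 i) (rootA 0 j)
    rw [h2, h4, inner_rootA, inner_rootA] at h5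
    simp only [rootA_apply, hij, hi, hj.symm, if_true, if_false] at h5
    by_cases e1 : a i = a j <;> by_cases e2 : b i = b j
    · rw [e1, e2] at h5
      simp [h3, h3.symm] at h5
    · exact Or.inl ⟨e1, e2⟩
    · exact Or.inr ⟨e1, e2⟩
    · simp only [e1, e2, if_false] at h5
      split_ifs at h5 <;> norm_num at h5
  -- Pairwise agreement becomes global: if two images differ in the first index they share the
  -- second, and an image with another second index would share its first index with both.
  have hcases : (∃ c, ∀ i, i ≠ 0 → a i = c) ∨ ∃ c, ∀ i, i ≠ 0 → b i = c := by
    by_cases h : ∃ i j, i ≠ 0 ∧ j ≠ 0 ∧ a i ≠ a j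
    · obtain ⟨i, j, hi, hj, hne⟩ := h
      have hbij : b i = b j :=
        ((hinner i j hi hj (by rintro rfl; exact hne rfl)).resolve_left fun h => hne h.1).2
      refine Or.inr ⟨b i, fun m hm => ?_⟩
      by_contra hb
      have h1 : a m = a i := ((hinner m i hm hi (by rintro rfl; exact hb rfl)).resolve_right
        fun h => hb h.2).1
      have h2 : a m = a j := ((hinner m j hm hj (by rintro rfl; exact hb hbij.symm)).resolve_right
        fun h => hb (h.2.trans hbij.symm)).1
      exact hne (h1.symm.trans h2)
    · push Not at h
      by_cases hex : ∃ i : Fin (n + 1), i ≠ 0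
      · obtain ⟨i, hi⟩ := hex
        exact Or.inl ⟨a i, fun m hm => h m i hm hi⟩
      · exact Or.inl ⟨0, fun m hm => absurd ⟨m, hm⟩ hex⟩
  rcases hcases with ⟨c, hc⟩ | ⟨c, hc⟩
  · obtain ⟨σ, hσ⟩ := exists_perm_of_common_index (T := T) (a := c)
      fun i hi => ⟨b i, by rw [(hab i hi).2, hc i hi]⟩
    exact ⟨σ, Or.inl hσ⟩
  · obtain ⟨σ, hσ⟩ := exists_perm_of_common_index (T := T.trans (LinearIsometryEquiv.neg ℝ))
      (a := c) fun i hi => ⟨a i, by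
        rw [LinearIsometryEquiv.trans_apply, (hab i hi).2, hc i hi, rootA_swap]; simp⟩
    refine ⟨σ, Or.inr fun i j => ?_⟩
    rw [rootA_swap, ← hσ]
    simp

end Automorphisms
-- A family and its normal lines determine each other.
section Simplices

variable {n : ℕ}

/-- This supplies the dual basis of `f`, used below as test vectors. A vector orthogonal to all the
normals is 0, so the pairing map is injective, hence surjective by dimension. -/
theorem IsNormalSystem.exists_inner_eq {f : Fin n → EuSp n} (hf : IsNormalSystem f)
    (c : Fin n → ℝ) : ∃ x, ∀ k, inner ℝ (f k) x = c k := by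
  let L : EuSp n →ₗ[ℝ] (Fin n → ℝ) := LinearMap.pi fun k => (innerSL ℝ (f k)).toLinearMap
  have hL : ∀ x k, L x k = inner ℝ (f k) x := fun x k => rfl
  have hinj : Function.Injective L := by
    rw [injective_iff_map_eq_zero]
    intro x hx
    have h0 : ∀ y ∈ Submodule.span ℝ (Set.range f), inner ℝ y x = 0 := by
      intro y hy
      induction hy using Submodule.span_induction with
      | mem y hy =>
        obtain ⟨k, rfl⟩ := hy
        rw [← hL, hx]
        rfl
      | zero => simp
      | add y z _ _ hy hz => rw [inner_add_left, hy, hz, add_zero]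
      | smul c y _ hy => rw [real_inner_smul_left, hy, mul_zero]
    exact inner_self_eq_zero.1 (h0 x (hf.span_eq_top ▸ Submodule.mem_top))
  obtain ⟨x, hx⟩ := (LinearMap.injective_iff_surjective_of_finrank_eq_finrank (by simp)).1 hinj c
  exact ⟨x, fun k => by rw [← hL, hx]⟩

theorem inner_nonpos_of_sphericalSimplex_subset {f g : Fin n → EuSp n}
    (h : sphericalSimplex g ⊆ sphericalSimplex f) {x : EuSp n}
    (hx : ∀ k, inner ℝ (g k) x ≤ 0) (k : Fin n) : inner ℝ (f k) x ≤ 0 := by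
  by_cases h0 : x = 0
  · simp [h0]
  have hpos : 0 < ‖x‖⁻¹ := inv_pos.2 (norm_pos_iff.2 h0)
  have hmem : ‖x‖⁻¹ • x ∈ sphericalSimplex g := by
    refine ⟨by rw [norm_smul, norm_inv, norm_norm, inv_mul_cancel₀ (norm_ne_zero_iff.2 h0)], ?_⟩
    intro l
    rw [real_inner_smul_right]
    exact mul_nonpos_of_nonneg_of_nonpos hpos.le (hx l)
  have := (h hmem).2 k
  rw [real_inner_smul_right] at this
  exact nonpos_of_mul_nonpos_right this hpos

/-- Farkas' lemma for a simplicial cone: minus the `l`-th dual basis vector lies in the cone of `g`,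
and pairing it with `f k` gives `-a l ≤ 0`. -/
theorem exists_nonneg_combination {f g : Fin n → EuSp n} (hg : IsNormalSystem g)
    (h : sphericalSimplex g ⊆ sphericalSimplex f) (k : Fin n) :
    ∃ a : Fin n → ℝ, (∀ l, 0 ≤ a l) ∧ f k = ∑ l, a l • g l := by
  have hk : f k ∈ Submodule.span ℝ (Set.range g) := hg.span_eq_top ▸ Submodule.mem_top
  obtain ⟨a, ha⟩ := (Submodule.mem_span_range_iff_exists_fun ℝ).1 hk
  refine ⟨a, fun l => ?_, ha.symm⟩
  obtain ⟨x, hx⟩ := hg.exists_inner_eq (Pi.single l (-1))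
  have h1 := inner_nonpos_of_sphericalSimplex_subset h (x := x) (fun m => by
    rw [hx]
    by_cases hm : m = l
    · subst hm
      simp
    · simp [hm]) k
  rw [← ha, sum_inner] at h1
  simp only [real_inner_smul_left, hx] at h1
  simpa [Pi.single_apply] using h1

/-- The outward normals of a simplex are determined by the simplex. -/
theorem exists_smul_of_sphericalSimplex_eq {f g : Fin n → EuSp n} (hf : IsNormalSystem f)
    (hg : IsNormalSystem g) (h : sphericalSimplex f = sphericalSimplex g) (k : Fin n) :
    ∃ l, ∃ c : ℝ, f k = c • g l := by
  choose a ha hfa using exists_nonneg_combination hg h.ge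
  choose b hb hgb using exists_nonneg_combination hf h.le
  have hsum : f k = ∑ m, (∑ l, a k l * b l m) • f m := by
    calc f k = ∑ l, a k l • g l := hfa k
      _ = ∑ l, ∑ m, (a k l * b l m) • f m := by
        refine Finset.sum_congr rfl fun l _ => ?_
        rw [hgb l, Finset.smul_sum]
        exact Finset.sum_congr rfl fun m _ => smul_smul _ _ _
      _ = _ := by
        rw [Finset.sum_comm]
        exact Finset.sum_congr rfl fun m _ => (Finset.sum_smul).symm
  -- The nonnegative matrices `a` and `b` multiply to the identity, so each term of an off-diagonal
  -- entry vanishes.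
  have hcoef : ∀ m, m ≠ k → ∀ l, a k l * b l m = 0 := by
    intro m hm
    obtain ⟨x, hx⟩ := hf.exists_inner_eq (Pi.single m 1)
    have h1 := congrArg (fun y => inner ℝ y x) hsum
    simp only [sum_inner, real_inner_smul_left, hx] at h1
    simp only [Pi.single_apply, hm.symm, if_false, mul_ite, mul_one, mul_zero,
      Finset.sum_ite_eq', Finset.mem_univ, if_true] at h1
    intro l
    exact (Finset.sum_eq_zero_iff_of_nonneg fun l _ => mul_nonneg (ha k l) (hb l m)).1 h1.symm l
      (Finset.mem_univ l)
  obtain ⟨l, hl⟩ : ∃ l, a k l ≠ 0 := by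
    by_contra! h0
    apply hf.ne_zero k
    rw [hfa k]
    simp [h0]
  -- As `a k l ≠ 0`, row `l` of `b` is supported at `k`.
  have hgl : g l = b l k • f k := by
    rw [hgb l]
    refine Finset.sum_eq_single k (fun m _ hm => ?_) (by simp)
    rw [(mul_eq_zero.1 (hcoef m hm l)).resolve_left hl, zero_smul]
  have hbl : b l k ≠ 0 := by
    intro h0
    rw [h0, zero_smul] at hgl
    exact hg.ne_zero l hgl
  exact ⟨l, (b l k)⁻¹, by rw [hgl, smul_smul, inv_mul_cancel₀ hbl, one_smul]⟩

theorem units_smul_eq_smul (ε : ℤˣ) (x : EuSp n) : ε • x = ((ε : ℤ) : ℝ) • x := by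
  rw [Units.smul_def, Int.cast_smul_eq_zsmul]

theorem norm_units_smul (ε : ℤˣ) (x : EuSp n) : ‖ε • x‖ = ‖x‖ := by
  rcases Int.units_eq_one_or ε with rfl | rfl <;> simp [Units.smul_def]

theorem IsNormalSystem.units_smul {f : Fin n → EuSp n} (hf : IsNormalSystem f)
    (ε : Fin n → ℤˣ) : IsNormalSystem fun k => ε k • f k := by
  refine ⟨?_, fun k => by rw [norm_units_smul, hf.2]⟩
  have := hf.1.units_smul fun k => Units.map (Int.castRingHom ℝ).toMonoidHom (ε k)
  convert this using 1
  ext1 k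
  rw [units_smul_eq_smul]
  rfl

/-- The hyperplanes of a family are determined by the family. -/
theorem exists_smul_of_simplexFamily_eq {f g : Fin n → EuSp n} (hf : IsNormalSystem f)
    (hg : IsNormalSystem g) (h : simplexFamily f = simplexFamily g) (k : Fin n) :
    ∃ l, ∃ c : ℝ, c ≠ 0 ∧ f k = c • g l := by
  -- A single common simplex already determines all the lines.
  have hmem : sphericalSimplex f ∈ simplexFamily g := by
    rw [← h]
    exact ⟨1, by simp⟩
  obtain ⟨ε, hε⟩ := hmem
  obtain ⟨l, c, hc⟩ := exists_smul_of_sphericalSimplex_eq hf (hg.units_smul ε) hε.symm k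
  rw [units_smul_eq_smul, smul_smul] at hc
  refine ⟨l, _, fun h0 => ?_, hc⟩
  rw [h0, zero_smul] at hc
  exact hf.ne_zero k hc

theorem simplexFamily_subset_of_eq {f g : Fin n → EuSp n} (π : Equiv.Perm (Fin n))
    (ε : Fin n → ℤˣ) (h : ∀ k, f k = ε k • g (π k)) : simplexFamily f ⊆ simplexFamily g := by
  rintro _ ⟨δ, rfl⟩
  refine ⟨fun l => δ (π.symm l) * ε (π.symm l), ?_⟩
  ext x
  refine and_congr_right fun _ => ?_
  rw [← π.forall_congr_right]
  simp only [Equiv.symm_apply_apply, mul_smul, h]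

theorem simplexFamily_eq_of_eq {f g : Fin n → EuSp n} (π : Equiv.Perm (Fin n))
    (ε : Fin n → ℤˣ) (h : ∀ k, f k = ε k • g (π k)) : simplexFamily f = simplexFamily g := by
  refine (simplexFamily_subset_of_eq π ε h).antisymm
    (simplexFamily_subset_of_eq π.symm (fun k => (ε (π.symm k))⁻¹) fun k => ?_)
  rw [h, smul_smul, inv_mul_cancel, one_smul, π.apply_symm_apply]

theorem exists_units_smul_of_norm_eq_one {x y : EuSp n} (hx : ‖x‖ = 1) (hy : ‖y‖ = 1) {c : ℝ}
    (h : x = c • y) : ∃ ε : ℤˣ, x = ε • y := by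
  have hc : |c| = 1 := by
    rw [h, norm_smul, hy, mul_one] at hx
    exact hx
  rcases eq_or_eq_neg_of_abs_eq hc with rfl | rfl
  · exact ⟨1, by simpa using h⟩
  · exact ⟨-1, by simpa [Units.smul_def] using h⟩

/-- Normal systems spanning the same lines define the same family. -/
theorem simplexFamily_eq_of_smul {f g : Fin n → EuSp n} (hf : IsNormalSystem f)
    (hg : IsNormalSystem g) (h : ∀ k, ∃ l, ∃ c : ℝ, f k = c • g l) :
    simplexFamily f = simplexFamily g := by
  choose s c hc using h
  choose ε hε using fun k => exists_units_smul_of_norm_eq_one (hf.2 k) (hg.2 _) (hc k)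
  have hinj : Function.Injective s := by
    intro k l e
    have h1 : g (s k) = ((((ε k)⁻¹ : ℤˣ) : ℤ) : ℝ) • f k := by
      rw [← units_smul_eq_smul, hε k, inv_smul_smul]
    refine (hf.1.eq_of_smul_apply_eq_smul_apply 1 (c l * ((((ε k)⁻¹ : ℤˣ) : ℤ) : ℝ)) l k
      one_ne_zero ?_).symm
    rw [one_smul, mul_smul, ← h1, hc l, e]
  exact simplexFamily_eq_of_eq (Equiv.ofBijective s (Finite.injective_iff_bijective.1 hinj)) ε hε

theorem image_sphericalSimplex (T : EuSp n ≃ₗᵢ[ℝ] EuSp n) (f : Fin n → EuSp n) :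
    T '' sphericalSimplex f = sphericalSimplex fun k => T (f k) := by
  ext x
  constructor
  · rintro ⟨y, ⟨hy, hy'⟩, rfl⟩
    exact ⟨by rw [T.norm_map, hy], fun k => by rw [T.inner_map_map]; exact hy' k⟩
  · rintro ⟨hx, hx'⟩
    refine ⟨T.symm x, ⟨by rw [T.symm.norm_map, hx], fun k => ?_⟩, T.apply_symm_apply x⟩
    rw [← T.inner_map_map, T.apply_symm_apply]
    exact hx' k

theorem image_simplexFamily (T : EuSp n ≃ₗᵢ[ℝ] EuSp n) (f : Fin n → EuSp n) :
    (fun P => T '' P) '' simplexFamily f = simplexFamily fun k => T (f k) := by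
  rw [simplexFamily, simplexFamily, ← Set.range_comp]
  congr 1
  ext1 ε
  simp only [Function.comp, image_sphericalSimplex]
  congr 1
  ext1 k
  rw [units_smul_eq_smul, units_smul_eq_smul, map_smul]

end Simplices

/-! ### The correspondence between families and trees. -/

section Correspondence

variable {n : ℕ}

/-- Two embeddings of the same normal system have isomorphic graphs. -/
theorem embeddingGraph_iso_of_embeddings {f : Fin n → EuSp n} {φ ψ : EuSp n ≃ₗᵢ[ℝ] sumZero n}
    (hf : IsNormalSystem f) (hφ : IsEmbeddingA f φ) (hψ : IsEmbeddingA f ψ) :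
    Nonempty (embeddingGraph f φ ≃g embeddingGraph f ψ) := by
  let U : sumZero n ≃ₗᵢ[ℝ] sumZero n := φ.symm.trans ψ
  have hU : ∀ x, U (φ x) = ψ x := fun x => by simp [U]
  obtain ⟨σ, hσ⟩ := exists_perm_of_map_roots U (by
    intro i j hij
    -- The preimage under `φ` of a root reflection lies in the group of `f`, so `ψ` carries it into
    -- the Weyl group; thus `U` maps root lines to root lines, and lengths leave only a sign.
    have h1 : isometryConj φ (Submodule.span ℝ {φ.symm (rootA i j)})ᗮ.reflection ∈ weylA n := by
      rw [isometryConj_reflection, φ.apply_symm_apply]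
      exact Subgroup.subset_closure ⟨i, j, hij, rfl⟩
    rw [isometryConj_mem_weylA_iff hf hφ, ← isometryConj_mem_weylA_iff hf hψ,
      isometryConj_reflection] at h1
    change (Submodule.span ℝ {U (rootA i j)})ᗮ.reflection ∈ weylA n at h1
    obtain ⟨k, l, hkl, c, hc, h⟩ := exists_rootA_of_reflection_mem_weylA
      (by simpa using rootA_ne_zero hij) h1
    have hc1 : c * c = 1 := by
      have h2 := congrArg (fun x => ‖x‖ ^ 2) h
      simp only [norm_smul, mul_pow, U.norm_map, norm_rootA_sq hij, norm_rootA_sq hkl,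
        Real.norm_eq_abs, sq_abs] at h2
      linarith
    rcases mul_self_eq_one_iff.1 hc1 with rfl | rfl
    · exact ⟨k, l, hkl, by rw [← h, one_smul]⟩
    · exact ⟨l, k, hkl.symm, by rw [rootA_swap k l, ← h, neg_one_smul, neg_neg]⟩)
  have hadj : ∀ i j, (embeddingGraph f φ).Adj i j ↔
      i ≠ j ∧ ∃ k, ∃ c : ℝ, c ≠ 0 ∧ c • ψ (f k) = U (rootA i j) := fun i j => by
    refine and_congr_right fun _ => exists_congr fun k => exists_congr fun c =>
      and_congr_right fun _ => ?_
    rw [← hU, ← map_smul U, U.injective.eq_iff]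
  refine ⟨⟨σ, fun {i j} => ?_⟩⟩
  rw [hadj]
  rcases hσ with hσ | hσ
  · simp only [hσ]
    exact and_congr_left fun _ => σ.injective.ne_iff
  · rw [SimpleGraph.adj_comm]
    simp only [hσ]
    exact and_congr_left fun _ => σ.injective.ne_iff.trans ne_comm

/-- Congruent families have isomorphic graphs. -/
theorem embeddingGraph_iso_of_congruent {f g : Fin n → EuSp n} {φ ψ : EuSp n ≃ₗᵢ[ℝ] sumZero n}
    (hf : IsNormalSystem f) (hg : IsNormalSystem g) (hφ : IsEmbeddingA f φ)
    (hψ : IsEmbeddingA g ψ) (h : FamilyCongruent (simplexFamily f) (simplexFamily g)) :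
    Nonempty (embeddingGraph f φ ≃g embeddingGraph g ψ) := by
  obtain ⟨T, hT⟩ := h
  rw [image_simplexFamily] at hT
  have h1 := exists_smul_of_simplexFamily_eq (hf.map T) hg hT
  have h2 := exists_smul_of_simplexFamily_eq hg (hf.map T) hT.symm
  -- Since the vectors `T (f k)` and the `g l` span the same lines, `ψ` after `T` embeds `f` with
  -- the same graph as `g`; two embeddings of `f` remain to be compared.
  have hTψ : IsEmbeddingA f (T.trans ψ) := by
    intro k
    obtain ⟨l, c, hc, hl⟩ := h1 k
    obtain ⟨i, j, hij, d, hd, hr⟩ := hψ l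
    refine ⟨i, j, hij, d / c, div_ne_zero hd hc, ?_⟩
    rw [LinearIsometryEquiv.trans_apply, hl, map_smul, smul_smul, div_mul_cancel₀ _ hc, hr]
  have hgraph : embeddingGraph f (T.trans ψ) = embeddingGraph g ψ := by
    ext i j
    refine and_congr_right fun _ => ⟨?_, ?_⟩
    · rintro ⟨k, d, hd, hr⟩
      obtain ⟨l, c, hc, hl⟩ := h1 k
      rw [LinearIsometryEquiv.trans_apply, hl, map_smul, smul_smul] at hr
      exact ⟨l, _, mul_ne_zero hd hc, hr⟩
    · rintro ⟨k, d, hd, hr⟩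
      obtain ⟨l, c, hc, hl⟩ := h2 k
      rw [hl, map_smul, smul_smul] at hr
      exact ⟨l, _, mul_ne_zero hd hc, hr⟩
  rw [← hgraph]
  exact embeddingGraph_iso_of_embeddings hf hφ hTψ

/-- Families with isomorphic graphs are congruent. -/
theorem familyCongruent_of_iso {f g : Fin n → EuSp n} {φ ψ : EuSp n ≃ₗᵢ[ℝ] sumZero n}
    (hf : IsNormalSystem f) (hg : IsNormalSystem g) (hφ : IsEmbeddingA f φ)
    (σ : embeddingGraph f φ ≃g embeddingGraph g ψ) :
    FamilyCongruent (simplexFamily f) (simplexFamily g) := by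
  let T : EuSp n ≃ₗᵢ[ℝ] EuSp n := (φ.trans (permA σ.toEquiv)).trans ψ.symm
  refine ⟨T, ?_⟩
  rw [image_simplexFamily]
  refine simplexFamily_eq_of_smul (hf.map T) hg fun k => ?_
  obtain ⟨i, j, hij, c, hc, h⟩ := hφ k
  have hadj : (embeddingGraph f φ).Adj i j := ⟨hij, k, c, hc, h⟩
  obtain ⟨-, l, d, hd, h'⟩ := σ.map_adj_iff.2 hadj
  refine ⟨l, c⁻¹ * d, ?_⟩
  apply ψ.injective
  rw [map_smul, mul_smul, h']
  change ψ (ψ.symm (permA σ.toEquiv (φ (f k)))) = c⁻¹ • rootA (σ.toEquiv i) (σ.toEquiv j)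
  rw [ψ.apply_symm_apply, ← permA_rootA, ← h, map_smul, smul_smul, inv_mul_cancel₀ hc, one_smul]

/-- Roots telescope along a walk. -/
theorem rootA_mem_of_reachable {Γ : SimpleGraph (Fin (n + 1))} {S : Submodule ℝ (sumZero n)}
    (hS : ∀ i j, Γ.Adj i j → rootA i j ∈ S) {i j : Fin (n + 1)} (h : Γ.Reachable i j) :
    rootA i j ∈ S := by
  obtain ⟨w⟩ := h
  induction w with
  | nil => rw [rootA_self]; exact S.zero_mem
  | cons h w ih => rw [← rootA_add]; exact S.add_mem (hS _ _ h) ih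

/-- Every tree is the graph of an embedded normal system. -/
theorem exists_embeddingGraph_eq {Γ : SimpleGraph (Fin (n + 1))} (hΓ : Γ.IsTree) :
    ∃ f : Fin n → EuSp n, IsNormalSystem f ∧ ∃ φ : EuSp n ≃ₗᵢ[ℝ] sumZero n,
      IsEmbeddingA f φ ∧ Γ = embeddingGraph f φ := by
  have hcard : Nat.card Γ.edgeSet = n := by
    have := (SimpleGraph.isTree_iff_connected_and_card.1 hΓ).2
    rw [Nat.card_fin] at this
    exact Nat.succ_injective this
  let e : Fin n ≃ Γ.edgeSet := ((Finite.equivFin Γ.edgeSet).trans (finCongr hcard)).symm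
  have hex : ∀ k, ∃ a b, s(a, b) = (e k : Sym2 (Fin (n + 1))) := fun k =>
    Sym2.ind (fun a b => ⟨a, b, rfl⟩) (e k : Sym2 (Fin (n + 1)))
  choose a b hab using hex
  have hadj : ∀ k, Γ.Adj (a k) (b k) := fun k => by
    rw [← SimpleGraph.mem_edgeSet, hab]
    exact (e k).2
  have hroot : ∀ i j, Γ.Adj i j → ∃ k, ∃ c : ℝ, c ≠ 0 ∧ c • rootA (a k) (b k) = rootA i j := by
    intro i j hij
    obtain ⟨k, hk⟩ := e.surjective ⟨s(i, j), hij⟩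
    have h1 : s(a k, b k) = s(i, j) := by rw [hab, hk]
    refine ⟨k, ?_⟩
    rcases Sym2.eq_iff.1 h1 with ⟨h1, h2⟩ | ⟨h1, h2⟩
    · exact ⟨1, one_ne_zero, by rw [h1, h2, one_smul]⟩
    · exact ⟨-1, by norm_num, by rw [h1, h2, rootA_swap i j, neg_one_smul, neg_neg]⟩
  -- A connected graph yields every `h_i - h_0`, and these span `V`. Being `n` in number, the edge
  -- roots are then independent.
  have hspan : ⊤ ≤ Submodule.span ℝ (Set.range fun k => rootA (a k) (b k)) := by
    intro x _
    rw [sumZero_eq_sum x 0]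
    refine Submodule.sum_mem _ fun i _ => Submodule.smul_mem _ _
      (rootA_mem_of_reachable (Γ := Γ) (fun i j hij => ?_) (hΓ.connected.preconnected i 0))
    obtain ⟨k, c, -, h⟩ := hroot i j hij
    rw [← h]
    exact Submodule.smul_mem _ _ (Submodule.subset_span ⟨k, rfl⟩)
  have hli : LinearIndependent ℝ fun k => rootA (a k) (b k) :=
    linearIndependent_of_top_le_span_of_card_eq_finrank hspan (by
      rw [finrank_sumZero, Fintype.card_fin])
  let φ : EuSp n ≃ₗᵢ[ℝ] sumZero n :=
    ((stdOrthonormalBasis ℝ (sumZero n)).reindex (finCongr finrank_sumZero)).repr.symm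
  have h2 : √2 ≠ 0 := by positivity
  -- Roots have length `√2`; the factor makes the normals unit vectors.
  let f : Fin n → EuSp n := fun k => φ.symm ((√2)⁻¹ • rootA (a k) (b k))
  have hφf : ∀ k, φ (f k) = (√2)⁻¹ • rootA (a k) (b k) := fun k => φ.apply_symm_apply _
  refine ⟨f, ⟨?_, fun k => ?_⟩, φ, fun k => ⟨a k, b k, (hadj k).ne, √2, h2, ?_⟩, ?_⟩
  · have h3 := hli.units_smul fun _ => (Units.mk0 (√2) h2)⁻¹
    exact h3.map' φ.symm.toLinearEquiv.toLinearMap φ.symm.toLinearEquiv.ker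
  · have h3 : ‖rootA (a k) (b k)‖ = √2 := by
      rw [← norm_rootA_sq (hadj k).ne, Real.sqrt_sq (norm_nonneg _)]
    rw [← φ.norm_map, hφf, norm_smul, h3, norm_inv, Real.norm_of_nonneg (Real.sqrt_nonneg 2),
      inv_mul_cancel₀ h2]
  · rw [hφf, smul_smul, mul_inv_cancel₀ h2, one_smul]
  · ext i j
    constructor
    · intro hij
      obtain ⟨k, c, hc, h⟩ := hroot i j hij
      refine ⟨hij.ne, k, c * √2, mul_ne_zero hc h2, ?_⟩
      rw [hφf, smul_smul, mul_assoc, mul_inv_cancel₀ h2, mul_one, h]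
    · rintro ⟨hij, k, c, -, h⟩
      rw [hφf, smul_smul] at h
      rw [← SimpleGraph.mem_edgeSet, ← sym2_eq_of_smul_rootA_eq (hadj k).ne hij h]
      exact hadj k

theorem exists_isGraphOfFamily {Φ : Set (Set (EuSp n))} (h : GeneratesA Φ) :
    ∃ Γ : SimpleGraph (Fin (n + 1)), IsGraphOfFamily Φ Γ := by
  obtain ⟨f, hf, rfl, φ, hφ⟩ := h
  exact ⟨_, f, hf, rfl, φ, isEmbeddingA_of_conj hf fun g hg => (hφ g).1 hg, rfl⟩

theorem IsGraphOfFamily.isTree {Φ : Set (Set (EuSp n))} {Γ : SimpleGraph (Fin (n + 1))}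
    (h : IsGraphOfFamily Φ Γ) : Γ.IsTree := by
  obtain ⟨f, hf, rfl, φ, hφ, rfl⟩ := h
  exact embeddingGraph_isTree hf hφ

theorem IsGraphOfFamily.generatesA {Φ : Set (Set (EuSp n))} {Γ : SimpleGraph (Fin (n + 1))}
    (h : IsGraphOfFamily Φ Γ) : GeneratesA Φ := by
  obtain ⟨f, hf, rfl, φ, hφ, rfl⟩ := h
  exact ⟨f, hf, rfl, φ, fun g => (isometryConj_mem_weylA_iff hf hφ g).symm⟩

/-- One direction makes the class of the tree independent of all choices, the other makes the
correspondence injective. -/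
theorem IsGraphOfFamily.familyCongruent_iff {Φ Ψ : Set (Set (EuSp n))}
    {Γ Δ : SimpleGraph (Fin (n + 1))} (h : IsGraphOfFamily Φ Γ) (h' : IsGraphOfFamily Ψ Δ) :
    FamilyCongruent Φ Ψ ↔ Nonempty (Γ ≃g Δ) := by
  obtain ⟨f, hf, rfl, φ, hφ, rfl⟩ := h
  obtain ⟨g, hg, rfl, ψ, hψ, rfl⟩ := h'
  exact ⟨embeddingGraph_iso_of_congruent hf hg hφ hψ,
    fun ⟨σ⟩ => familyCongruent_of_iso hf hg hφ σ⟩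

theorem exists_familyA_isGraphOfFamily {Γ : SimpleGraph (Fin (n + 1))} (hΓ : Γ.IsTree) :
    ∃ Φ : FamilyA n, IsGraphOfFamily Φ.1 Γ := by
  obtain ⟨f, hf, φ, hφ, h⟩ := exists_embeddingGraph_eq hΓ
  have hfam : IsGraphOfFamily (simplexFamily f) Γ := ⟨f, hf, rfl, φ, hφ, h⟩
  exact ⟨⟨_, hfam.generatesA⟩, hfam⟩

end Correspondence

theorem theorem1 (n : ℕ) (hn : 1 ≤ n) :
    (∀ Φ : FamilyA n, ∃ Γ : SimpleGraph (Fin (n + 1)), IsGraphOfFamily Φ.1 Γ) ∧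
    (∀ (Φ : FamilyA n) (Γ : SimpleGraph (Fin (n + 1))), IsGraphOfFamily Φ.1 Γ → Γ.IsTree) ∧
    ∃ e : FamilyClassA n ≃ TreeClass n,
      ∀ (Φ : FamilyA n) (Γ : TreeOn n), IsGraphOfFamily Φ.1 Γ.1 →
        e (Quotient.mk (familySetoid n) Φ) = Quotient.mk (treeSetoid n) Γ := by
  refine ⟨fun Φ => exists_isGraphOfFamily Φ.2, fun _ _ h => h.isTree, ?_⟩
  -- An arbitrary graph is chosen for each family; only its isomorphism class matters.
  choose G hG using fun Φ : FamilyA n => exists_isGraphOfFamily Φ.2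
  let tree : FamilyA n → TreeOn n := fun Φ => ⟨G Φ, (hG Φ).isTree⟩
  let F : FamilyClassA n → TreeClass n := Quotient.lift
    (fun Φ => Quotient.mk (treeSetoid n) (tree Φ))
    fun Φ Ψ h => Quotient.sound (((hG Φ).familyCongruent_iff (hG Ψ)).1 h)
  have hF : ∀ (Φ : FamilyA n) (Γ : TreeOn n), IsGraphOfFamily Φ.1 Γ.1 →
      F (Quotient.mk (familySetoid n) Φ) = Quotient.mk (treeSetoid n) Γ := fun Φ Γ h =>
    Quotient.sound (((hG Φ).familyCongruent_iff h).1 (FamilyCongruent.refl Φ.1))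
  refine ⟨Equiv.ofBijective F ⟨?_, ?_⟩, hF⟩
  · intro x y
    induction x using Quotient.inductionOn with
    | _ Φ =>
    induction y using Quotient.inductionOn with
    | _ Ψ =>
    intro h
    exact Quotient.sound (((hG Φ).familyCongruent_iff (hG Ψ)).2 (Quotient.exact h))
  · intro y
    induction y using Quotient.inductionOn with
    | _ Γ =>
    obtain ⟨Φ, hΦ⟩ := exists_familyA_isGraphOfFamily Γ.2
    exact ⟨Quotient.mk _ Φ, hF Φ Γ hΦ⟩
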